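/- For $n\ge 0$ let $A'_n=\sum_{k=0}^{n}\binom{n}{k}^2\binom{n+k}{k}$ be the second Apéry numbers, and let the Bernoulli numbers $B_n$ be defined by $\frac{x}{e^x-1}=\sum_{n=0}^\infty B_n\frac{x^n}{n!}$. For every prime $p\ge 7$, $$A'_{p-1}\equiv 1+p^3\left(\frac{10}{3}B_{p-3}-\frac{5}{4}B_{2p-4}\right)+\frac{5}{18}p^4B_{p-3}\pmod{p^5},$$ where, for rational numbers $x,y$, $x\equiv y\pmod{p^5}$ means that $x-y=p^5z$ for some rational number $z$ whose denominator is not divisible by $p$. -/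

import Mathlib

/-- The second Apéry numbers `A'ₙ = ∑_{k=0}^{n} C(n,k)² C(n+k,k)`. -/
def aperyTwo (n : ℕ) : ℕ :=
  ∑ k ∈ Finset.range (n + 1), n.choose k ^ 2 * (n + k).choose k

/-- Congruence of rational numbers modulo `m`: the difference is `m` times a rational number
whose denominator (in lowest terms) is coprime to `m`. -/
def RatModEq (m : ℕ) (x y : ℚ) : Prop :=
  ∃ z : ℚ, z.den.Coprime m ∧ x - y = (m : ℚ) * z

/-! Write `A'ₙ` as the alternating sum `∑ (-1)^(n-k) C(n,k) C(n+k,n)²`. For `n = p - 1` every term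
with `k ≥ 1` has a factor `p²`, and expanding the binomial coefficients in powers of `p` turns the
sum into multiple harmonic sums over `1 ≤ k ≤ p - 1`. A duality of the binomial transform and the
reflection `k ↦ p - k` remove the sums of depth greater than one, leaving
`A'_{p-1} ≡ 1 + (5/2) p² H_{p-1}(2) (mod p⁵)`.

By Fermat `k⁻² (1 - k^(p-1))³ ≡ 0 (mod p³)`, so `H_{p-1}(2)` is a combination of power sums with
the positive exponents `p - 3`, `2p - 4`, `3p - 5`; Faulhaber's formula evaluates these through
Bernoulli numbers. Kummer's congruences for `Bₙ / n`, a consequence of Voronoi's congruence,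
eliminate `B_{3p-5}` and give the stated coefficients. -/

open Finset

section AlternatingSum

/-- The sum is the `m`-th forward difference of `l ↦ C(l, m + i)`. -/
theorem sum_neg_one_pow_mul_choose_mul_choose (m i N : ℕ) :
    ∑ l ∈ range (m + 1), (-1 : ℤ) ^ (m - l) * m.choose l * (N + l).choose (m + i) =
      N.choose i := by
  have h := congrFun (fwdDiff_iter_choose i m) N
  rw [fwdDiff_iter_eq_sum_shift] at h
  simpa using h

theorem add_choose_eq_sum_choose_mul_choose (n k : ℕ) :
    (n + k).choose n = ∑ i ∈ range (n + 1), n.choose i * k.choose i := by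
  rw [add_comm n k, Nat.add_choose_eq,
    Finset.Nat.sum_antidiagonal_eq_sum_range_succ fun a b => k.choose a * n.choose b]
  refine sum_congr rfl fun i hi => ?_
  rw [Nat.choose_symm (Nat.lt_succ_iff.mp (mem_range.mp hi)), mul_comm]

theorem aperyTwo_eq_alternating_sum (n : ℕ) :
    (aperyTwo n : ℤ) =
      ∑ k ∈ range (n + 1), (-1) ^ (n - k) * n.choose k * ((n + k).choose n : ℤ) ^ 2 := by
  have hsq (k : ℕ) : ((n + k).choose n : ℤ) ^ 2 =
      ∑ i ∈ range (n + 1),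
        (n.choose i * (n + i).choose i : ℤ) * (n + k).choose (n + i) := by
    have hterm (i : ℕ) : (n + k).choose n * (n.choose i * k.choose i) =
        n.choose i * (n + i).choose i * (n + k).choose (n + i) := by
      have h := Nat.choose_mul (n := n + k) (Nat.le_add_right n i)
      rw [Nat.choose_symm_add, Nat.add_sub_cancel_left, Nat.add_sub_cancel_left] at h
      rw [mul_left_comm, ← h]
      ring
    rw [sq]
    nth_rw 2 [add_choose_eq_sum_choose_mul_choose]
    exact_mod_cast (mul_sum ..).trans (sum_congr rfl fun i _ => hterm i)
  simp only [hsq, mul_sum]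
  rw [sum_comm, aperyTwo, Nat.cast_sum]
  refine sum_congr rfl fun i _ => ?_
  have h := congrArg ((n.choose i * (n + i).choose i : ℤ) * ·)
    (sum_neg_one_pow_mul_choose_mul_choose n i n)
  simp only [mul_sum] at h
  push_cast
  rw [sq, mul_right_comm, ← h]
  exact sum_congr rfl fun k _ => by ring

end AlternatingSum

section HarmonicSums

variable {R : Type*} [CommRing R]

/-- `x k` is the reciprocal of `k + 1` in `R` for all `k < N`. The shift lets harmonic sums over
`1 ≤ k ≤ N` run over `Finset.range N`. -/
def IsReciprocal (x : ℕ → R) (N : ℕ) : Prop :=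
  ∀ k < N, ((k : R) + 1) * x k = 1

/-- The multiple harmonic sum `∑_{n > k₁ > k₂ > ⋯} x(k₁)^a₁ x(k₂)^a₂ ⋯` of depth `s.length`, for
`s = [a₁, a₂, …]`. -/
def mhs (x : ℕ → R) : List ℕ → ℕ → R
  | [], _ => 1
  | a :: s, n => ∑ k ∈ range n, x k ^ a * mhs x s k

/-- The binomial transform `m ↦ ∑_{k=1}^m (-1)^k C(m,k) f(k)`, where `f k` stands for the value at
`k + 1`. -/
def binomTransform (f : ℕ → R) (m : ℕ) : R :=
  ∑ k ∈ range m, (-1) ^ (k + 1) * (m.choose (k + 1) : R) * f k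

theorem mhs_nil (x : ℕ → R) (n : ℕ) : mhs x [] n = 1 := rfl

theorem mhs_cons (x : ℕ → R) (a : ℕ) (s : List ℕ) (n : ℕ) :
    mhs x (a :: s) n = ∑ k ∈ range n, x k ^ a * mhs x s k := rfl

theorem mhs_singleton (x : ℕ → R) (a n : ℕ) : mhs x [a] n = ∑ k ∈ range n, x k ^ a := by
  simp [mhs]

theorem mhs_cons_zero (x : ℕ → R) (a : ℕ) (s : List ℕ) : mhs x (a :: s) 0 = 0 := by
  simp [mhs]

theorem mhs_cons_succ (x : ℕ → R) (a : ℕ) (s : List ℕ) (n : ℕ) :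
    mhs x (a :: s) (n + 1) = mhs x (a :: s) n + x n ^ a * mhs x s n :=
  sum_range_succ ..

theorem mhs_singleton_succ (x : ℕ → R) (a n : ℕ) :
    mhs x [a] (n + 1) = mhs x [a] n + x n ^ a := by
  rw [mhs_cons_succ, mhs_nil, mul_one]

theorem map_mhs {S : Type*} [CommRing S] (φ : R →+* S) (x : ℕ → R) (s : List ℕ) (n : ℕ) :
    φ (mhs x s n) = mhs (φ ∘ x) s n := by
  induction s generalizing n with
  | nil => simp [mhs]
  | cons a s ih => simp [mhs, ih]

theorem mhs_mul_mhs (x : ℕ → R) (a b n : ℕ) :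
    mhs x [a] n * mhs x [b] n = mhs x [a, b] n + mhs x [b, a] n + mhs x [a + b] n := by
  induction n with
  | zero => simp only [mhs_cons_zero, mul_zero, add_zero]
  | succ n ih =>
    rw [mhs_cons_succ x a [b], mhs_cons_succ x b [a]]
    simp only [mhs_singleton_succ]
    linear_combination ih

theorem sum_pow_mul_mhs_singleton_succ (x : ℕ → R) (a b n : ℕ) :
    ∑ l ∈ range n, x l ^ a * mhs x [b] (l + 1) = mhs x [a, b] n + mhs x [a + b] n := by
  rw [mhs_cons, mhs_singleton, ← sum_add_distrib]
  refine sum_congr rfl fun l _ => ?_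
  rw [mhs_singleton_succ]
  ring

variable {x : ℕ → R} {N : ℕ}

theorem IsReciprocal.mono (hx : IsReciprocal x N) {m : ℕ} (hm : m ≤ N) : IsReciprocal x m :=
  fun k hk => hx k (hk.trans_le hm)

theorem IsReciprocal.map {S : Type*} [CommRing S] (hx : IsReciprocal x N) (φ : R →+* S) :
    IsReciprocal (φ ∘ x) N := fun k hk => by
  simpa using congrArg φ (hx k hk)

theorem IsReciprocal.add_reflect (hx : IsReciprocal x N) {k : ℕ} (hk : k < N) :
    x k + x (N - 1 - k) = (N + 1) * (x k * x (N - 1 - k)) := by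
  have h1 := hx (N - 1 - k) (by lia)
  have h2 : ((N - 1 - k : ℕ) : R) + 1 + (k + 1) = N + 1 := by
    exact_mod_cast congrArg (Nat.cast (R := R)) (show N - 1 - k + 1 + (k + 1) = N + 1 by lia)
  linear_combination (-x (N - 1 - k)) * hx k hk - x k * h1 + x k * x (N - 1 - k) * h2

theorem IsReciprocal.choose_mul (hx : IsReciprocal x N) {m k : ℕ} (hm : m < N) (hk : k ≤ m) :
    (m.choose k : R) * x k = x m * (m + 1).choose (k + 1) := by
  have h : ((m : R) + 1) * m.choose k = (m + 1).choose (k + 1) * ((k : R) + 1) := by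
    exact_mod_cast congrArg (Nat.cast (R := R)) (Nat.add_one_mul_choose_eq m k)
  linear_combination (-(m.choose k : R) * x k) * hx m hm + x m * x k * h +
    x m * ((m + 1).choose (k + 1) : R) * hx k (hk.trans_lt hm)

theorem binomTransform_mul_inv (hx : IsReciprocal x N) (f : ℕ → R) :
    binomTransform (fun k => f k * x k) N = ∑ l ∈ range N, x l * binomTransform f (l + 1) := by
  induction N with
  | zero => simp [binomTransform]
  | succ m ih =>
    have hpad : binomTransform (fun k => f k * x k) m =
        ∑ k ∈ range (m + 1), (-1) ^ (k + 1) * (m.choose (k + 1) : R) * (f k * x k) := by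
      simp [binomTransform, sum_range_succ]
    rw [sum_range_succ, ← ih (hx.mono m.le_succ), hpad, binomTransform, binomTransform, mul_sum,
      ← sum_add_distrib]
    refine sum_congr rfl fun k hk => ?_
    have h := hx.choose_mul m.lt_succ_self (Nat.lt_succ_iff.mp (mem_range.mp hk))
    have hpascal : ((m + 1).choose (k + 1) : R) = m.choose k + m.choose (k + 1) := by
      rw [Nat.choose_succ_succ', Nat.cast_add]
    linear_combination (-1) ^ (k + 1) * f k * h + (-1) ^ (k + 1) * f k * x k * hpascal

theorem binomTransform_sum_range (f : ℕ → R) (m : ℕ) :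
    binomTransform (fun k => ∑ j ∈ range (k + 1), f j) (m + 1) =
      ∑ j ∈ range (m + 1), (-1) ^ (j + 1) * (m.choose j : R) * f j := by
  have htelescope := Finset.sum_range_sub
    (fun k => (-1 : R) ^ k * (m.choose k : R) * ∑ j ∈ range k, f j) (m + 1)
  simp only [Nat.choose_succ_self, range_zero, sum_empty, Nat.cast_zero, mul_zero, zero_mul,
    sub_zero] at htelescope
  rw [binomTransform, ← sub_eq_zero, ← sum_sub_distrib, ← htelescope]
  refine sum_congr rfl fun k _ => ?_
  rw [Nat.choose_succ_succ', Nat.cast_add, sum_range_succ]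
  ring

theorem binomTransform_one (m : ℕ) : binomTransform (fun _ => (1 : R)) (m + 1) = -1 := by
  simpa using binomTransform_sum_range (R := R) (fun j => if j = 0 then 1 else 0) m

theorem binomTransform_sum_mul_inv (hx : IsReciprocal x N) (g : ℕ → R) {m : ℕ} (hm : m < N) :
    binomTransform (fun k => ∑ j ∈ range (k + 1), g j * x j) (m + 1) =
      x m * binomTransform g (m + 1) := by
  rw [binomTransform_sum_range, binomTransform, mul_sum]
  refine sum_congr rfl fun k hk => ?_
  linear_combination (-1) ^ (k + 1) * g k *
    hx.choose_mul hm (Nat.lt_succ_iff.mp (mem_range.mp hk))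

theorem binomTransform_mul_inv_sq (hx : IsReciprocal x N) {f : ℕ → R} {c : ℕ}
    (hf : ∀ m < N, binomTransform f (m + 1) = -x m ^ c) :
    binomTransform (fun k => f k * x k ^ 2) N =
      -(mhs x [1, c + 1] N + mhs x [c + 2] N) := by
  have h1 : ∀ l ∈ range N, x l * binomTransform (fun k => f k * x k) (l + 1) =
      -(x l ^ 1 * mhs x [c + 1] (l + 1)) := by
    intro l hl
    have hl : l + 1 ≤ N := Nat.succ_le_of_lt (mem_range.mp hl)
    rw [binomTransform_mul_inv (hx.mono hl), mhs_singleton, pow_one, ← mul_neg,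
      ← sum_neg_distrib]
    congr 1
    refine sum_congr rfl fun j hj => ?_
    rw [hf j ((mem_range.mp hj).trans_le hl)]
    ring
  simp only [sq, ← mul_assoc]
  rw [binomTransform_mul_inv hx, sum_congr rfl h1, sum_neg_distrib,
    sum_pow_mul_mhs_singleton_succ, show 1 + (c + 1) = c + 2 by ring]

theorem binomTransform_inv_sq (hx : IsReciprocal x N) :
    binomTransform (fun k => x k ^ 2) N = -(mhs x [1, 1] N + mhs x [2] N) := by
  have h := binomTransform_mul_inv_sq hx (f := fun _ => 1) (c := 0) fun m _ => by
    rw [binomTransform_one, pow_zero]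
  simpa only [one_mul] using h

theorem binomTransform_duality (hx : IsReciprocal x N) :
    binomTransform (fun k => (mhs x [1, 1] (k + 1) + mhs x [2] (k + 1)) * x k ^ 2) N =
      -(mhs x [1, 3] N + mhs x [4] N) := by
  refine binomTransform_mul_inv_sq hx (c := 2) fun m hm => ?_
  have hsum (k : ℕ) : mhs x [1, 1] (k + 1) + mhs x [2] (k + 1) =
      ∑ j ∈ range (k + 1), (∑ i ∈ range (j + 1), 1 * x i) * x j := by
    rw [← sum_pow_mul_mhs_singleton_succ]
    simp only [mhs_singleton, pow_one, one_mul, mul_comm (x _)]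
  simp only [hsum]
  rw [binomTransform_sum_mul_inv hx _ hm, binomTransform_sum_mul_inv hx _ hm, binomTransform_one]
  ring

end HarmonicSums

section Expansion

variable {R : Type*} [CommRing R] {x : ℕ → R} {n : ℕ}

theorem pow_three_dvd_prod_sub {f : ℕ → R} {t α β : R} {k : ℕ}
    (hf : ∀ j < k, t ^ 3 ∣ f j - (1 + α * (t * x j) + β * (t * x j) ^ 2)) :
    t ^ 3 ∣ ∏ j ∈ range k, f j -
      (1 + α * t * mhs x [1] k + t ^ 2 * (α ^ 2 * mhs x [1, 1] k + β * mhs x [2] k)) := by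
  induction k with
  | zero => simp [mhs]
  | succ k ih =>
    obtain ⟨c, hc⟩ := ih fun j hj => hf j (hj.trans k.lt_succ_self)
    obtain ⟨d, hd⟩ := hf k k.lt_succ_self
    rw [prod_range_succ, sub_eq_iff_eq_add.mp hc, sub_eq_iff_eq_add.mp hd, mhs_cons_succ x 1 [1],
      mhs_singleton_succ, mhs_singleton_succ]
    generalize mhs x [1] k = h1, mhs x [1, 1] k = h11, mhs x [2] k = h2
    refine ⟨c * (t ^ 3 * d + (1 + α * (t * x k) + β * (t * x k) ^ 2)) +
      (1 + α * t * h1 + t ^ 2 * (α ^ 2 * h11 + β * h2)) * d +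
      α * β * h1 * x k ^ 2 + (α ^ 2 * h11 + β * h2) * (α * x k + β * t * x k ^ 2), ?_⟩
    ring

theorem neg_one_pow_mul_choose_eq_prod (hx : IsReciprocal x n) {k : ℕ} (hk : k ≤ n) :
    (-1) ^ k * (n.choose k : R) = ∏ j ∈ range k, (1 - ((n : R) + 1) * x j) := by
  induction k with
  | zero => simp
  | succ k ih =>
    have h : (n.choose (k + 1) : R) * ((k : R) + 1) = n.choose k * ((n : R) - k) := by
      have := congrArg (Nat.cast (R := R)) (Nat.choose_succ_right_eq n k)
      push_cast [Nat.cast_sub (show k ≤ n by lia)] at this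
      exact this
    rw [prod_range_succ, ← ih (by lia)]
    linear_combination (-(-1) ^ (k + 1) * (n.choose (k + 1) : R) + (-1) ^ k * (n.choose k : R)) *
      hx k hk + (-1) ^ (k + 1) * x k * h

theorem add_choose_eq_prod (hx : IsReciprocal x n) (m : ℕ) {k : ℕ} (hk : k ≤ n) :
    ((m + k).choose k : R) = ∏ j ∈ range k, (1 + (m : R) * x j) := by
  induction k with
  | zero => simp
  | succ k ih =>
    have h : (((m : R) + k) + 1) * (m + k).choose k =
        (m + (k + 1)).choose (k + 1) * ((k : R) + 1) := by
      exact_mod_cast congrArg (Nat.cast (R := R)) (Nat.add_one_mul_choose_eq (m + k) k)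
    rw [prod_range_succ, ← ih (by lia)]
    linear_combination (-((m + (k + 1)).choose (k + 1) : R) + ((m + k).choose k : R)) * hx k hk
      - x k * h

theorem add_choose_succ_eq_prod (hx : IsReciprocal x n) (m : ℕ) {k : ℕ} (hk : k < n) :
    ((m + k).choose (k + 1) : R) = m * x k * ∏ j ∈ range k, (1 + (m : R) * x j) := by
  have h : ((m + k).choose (k + 1) : R) * ((k : R) + 1) = (m + k).choose k * m := by
    have := congrArg (Nat.cast (R := R)) (Nat.choose_succ_right_eq (m + k) k)
    rw [Nat.add_sub_cancel] at this
    exact_mod_cast this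
  rw [← add_choose_eq_prod hx m hk.le]
  linear_combination (-((m + k).choose (k + 1) : R)) * hx k hk + x k * h

theorem aperyTwo_eq_one_add_sum_prod (hx : IsReciprocal x n) (hn : Even n) {t : R}
    (ht : t = n + 1) :
    (aperyTwo n : R) = 1 + t ^ 2 * ∑ k ∈ range n,
      x k ^ 2 * (1 - t * x k) * ∏ j ∈ range k, (1 - t * x j) * (1 + t * x j) ^ 2 := by
  have h := congrArg (Int.cast (R := R)) (aperyTwo_eq_alternating_sum n)
  push_cast at h
  rw [h, sum_range_succ', mul_sum, add_comm]
  refine congrArg₂ _ (by simp [hn.neg_one_pow]) (sum_congr rfl fun k hk => ?_)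
  have hk : k + 1 ≤ n := Nat.succ_le_of_lt (mem_range.mp hk)
  have hsign : (-1 : R) ^ (n - (k + 1)) = (-1) ^ (k + 1) :=
    neg_one_pow_congr (by simp [Nat.even_sub hk, hn])
  rw [hsign, neg_one_pow_mul_choose_eq_prod hx hk, prod_range_succ, Nat.choose_symm_add,
    show n + (k + 1) = n + 1 + k by ring, add_choose_succ_eq_prod hx (n + 1) hk, prod_mul_distrib,
    prod_pow, ht]
  push_cast
  ring

theorem pow_five_dvd_aperyTwo_sub (hx : IsReciprocal x n) (hn : Even n) {t : R} (ht : t = n + 1) :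
    t ^ 5 ∣ (aperyTwo n : R) - 1 - t ^ 2 * (mhs x [2] n + t * (mhs x [2, 1] n - mhs x [3] n) +
      t ^ 2 * (mhs x [2, 1, 1] n - mhs x [2, 2] n - mhs x [3, 1] n)) := by
  rw [aperyTwo_eq_one_add_sum_prod hx hn ht, add_sub_cancel_left, ← mul_sub,
    show t ^ 5 = t ^ 2 * t ^ 3 by ring]
  refine mul_dvd_mul_left _ ?_
  simp only [mhs_cons x _ _ n, mhs_nil, mul_one, mul_sum, ← sum_sub_distrib, ← sum_add_distrib]
  refine dvd_sum fun k _ => ?_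
  obtain ⟨c, hc⟩ := pow_three_dvd_prod_sub (x := x) (k := k) (t := t) (α := 1) (β := -1)
    (f := fun j => (1 - t * x j) * (1 + t * x j) ^ 2) fun j _ => ⟨-x j ^ 3, by ring⟩
  rw [sub_eq_iff_eq_add.mp hc]
  refine ⟨x k ^ 2 * (1 - t * x k) * c - x k ^ 3 * (mhs x [1, 1] k - mhs x [2] k), ?_⟩
  ring

theorem pow_three_dvd_inv_sq_relation (hx : IsReciprocal x n) {t : R} (ht : t = n + 1) :
    t ^ 3 ∣ mhs x [1, 1] n + mhs x [2] n + (mhs x [2] n - t * (mhs x [3] n + mhs x [2, 1] n) +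
      t ^ 2 * (mhs x [3, 1] n + mhs x [2, 1, 1] n)) := by
  rw [← neg_eq_iff_eq_neg.mpr (binomTransform_inv_sq hx), binomTransform, neg_add_eq_sub,
    ← dvd_neg, neg_sub]
  simp only [mhs_cons x _ _ n, mhs_nil, mul_one, mul_sum, ← sum_sub_distrib, ← sum_add_distrib]
  refine dvd_sum fun k hk => ?_
  obtain ⟨c, hc⟩ := pow_three_dvd_prod_sub (x := x) (k := k) (t := t) (α := -1) (β := 0)
    (f := fun j => 1 - t * x j) fun j _ => ⟨0, by ring⟩
  rw [neg_one_pow_mul_choose_eq_prod hx (Nat.succ_le_of_lt (mem_range.mp hk)), prod_range_succ,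
    ← ht, sub_eq_iff_eq_add.mp hc]
  refine ⟨x k ^ 2 * (c * (1 - t * x k) - x k * mhs x [1, 1] k), ?_⟩
  ring

end Expansion

section Reflection

variable {R : Type*} [CommRing R] {x : ℕ → R} {N : ℕ}

theorem sq_dvd_two_mul_mhs_add (hx : IsReciprocal x N) {t : R} (ht : t = N + 1) {a : ℕ}
    (ha : Odd a) : t ^ 2 ∣ 2 * mhs x [a] N + a * t * mhs x [a + 1] N := by
  have hsum : 2 * mhs x [a] N + a * t * mhs x [a + 1] N =
      ∑ k ∈ range N, (x k ^ a + x (N - 1 - k) ^ a + a * t * x k ^ (a + 1)) := by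
    rw [sum_add_distrib, sum_add_distrib, sum_range_reflect (fun k => x k ^ a), ← mul_sum,
      ← mhs_singleton, ← mhs_singleton, two_mul]
  rw [hsum]
  refine dvd_sum fun k hk => ?_
  have hrefl := hx.add_reflect (mem_range.mp hk)
  rw [← ht] at hrefl
  obtain ⟨c, hc⟩ := Polynomial.powAddExpansion (-x k) (t * (x k * x (N - 1 - k))) a
  rw [← eq_neg_add_of_add_eq hrefl, ha.neg_pow, (Nat.Odd.sub_odd ha odd_one).neg_pow] at hc
  obtain ⟨b, rfl⟩ : ∃ b, a = b + 1 := Nat.exists_eq_add_one.mpr ha.pos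
  rw [Nat.add_sub_cancel] at hc
  refine ⟨((b + 1 : ℕ) : R) * x k ^ (b + 1) * (x k * x (N - 1 - k)) +
    c * (x k * x (N - 1 - k)) ^ 2, ?_⟩
  linear_combination hc + ((b + 1 : ℕ) : R) * t * x k ^ (b + 1) * hrefl

theorem IsReciprocal.reflect (hx : IsReciprocal x N) (hN : (N : R) + 1 = 0) {k : ℕ} (hk : k < N) :
    x (N - 1 - k) = -x k := by
  linear_combination hx.add_reflect hk + x k * x (N - 1 - k) * hN

theorem mhs_singleton_sub (hx : IsReciprocal x N) (hN : (N : R) + 1 = 0) {b : ℕ}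
    (hb : mhs x [b] N = 0) {k : ℕ} (hk : k ≤ N) :
    mhs x [b] (N - k) = -(-1) ^ b * mhs x [b] k := by
  induction k with
  | zero => rw [Nat.sub_zero, hb, mhs_cons_zero, mul_zero]
  | succ k ih =>
    have h := ih (by lia)
    have hsub : N - 1 - k = N - (k + 1) := by lia
    rw [show N - k = N - (k + 1) + 1 by lia, mhs_singleton_succ, ← hsub, hx.reflect hN hk,
      neg_pow] at h
    rw [mhs_singleton_succ, ← hsub]
    linear_combination h

theorem two_mul_mhs_pair_eq_zero (hx : IsReciprocal x N) (hN : (N : R) + 1 = 0) {a b : ℕ}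
    (hab : Even (a + b)) (hb : mhs x [b] N = 0) (hsum : mhs x [a + b] N = 0) :
    2 * mhs x [a, b] N = 0 := by
  have hterm : ∀ k ∈ range N, x (N - 1 - k) ^ a * mhs x [b] (N - 1 - k) =
      -(x k ^ a * mhs x [b] k + x k ^ (a + b)) := by
    intro k hk
    have hk := mem_range.mp hk
    rw [hx.reflect hN hk, show N - 1 - k = N - (k + 1) by lia,
      mhs_singleton_sub hx hN hb hk, mhs_singleton_succ, neg_pow]
    linear_combination (-(x k ^ a * mhs x [b] k + x k ^ (a + b))) * hab.neg_one_pow (α := R)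
  have h := sum_range_reflect (fun k => x k ^ a * mhs x [b] k) N
  rw [sum_congr rfl hterm, sum_neg_distrib, sum_add_distrib, ← mhs_cons, ← mhs_singleton,
    hsum] at h
  linear_combination -h

theorem binomTransform_eq_sum (hx : IsReciprocal x N) (hN : (N : R) + 1 = 0) (f : ℕ → R) :
    binomTransform f N = ∑ k ∈ range N, f k := by
  refine sum_congr rfl fun k hk => ?_
  rw [neg_one_pow_mul_choose_eq_prod hx (Nat.succ_le_of_lt (mem_range.mp hk)), hN]
  simp only [zero_mul, sub_zero, prod_const_one, one_mul]

theorem mhs_two_one_one_eq (hx : IsReciprocal x N) (hN : (N : R) + 1 = 0) :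
    mhs x [2, 1, 1] N =
      -(mhs x [1, 3] N + mhs x [3, 1] N + mhs x [2, 2] N + 2 * mhs x [4] N) := by
  have hsum : ∑ k ∈ range N, (mhs x [1, 1] (k + 1) + mhs x [2] (k + 1)) * x k ^ 2 =
      mhs x [2, 1, 1] N + mhs x [3, 1] N + mhs x [2, 2] N + mhs x [4] N := by
    simp only [mhs_cons x _ _ N, mhs_nil, ← sum_add_distrib]
    refine sum_congr rfl fun k _ => ?_
    rw [mhs_cons_succ x 1 [1], mhs_singleton_succ]
    ring
  have h := binomTransform_duality hx
  rw [binomTransform_eq_sum hx hN, hsum] at h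
  linear_combination h

end Reflection

section Residues

theorem sum_range_mul_mod {A : Type*} [AddCommMonoid A] {M a : ℕ} (hM : 0 < M)
    (ha : M.Coprime a) (g : ℕ → A) : ∑ k ∈ range M, g (k * a % M) = ∑ k ∈ range M, g k := by
  have hmaps : Set.MapsTo (fun k => k * a % M) (range M : Set ℕ) (range M : Set ℕ) :=
    fun k _ => by simpa using Nat.mod_lt _ hM
  have hinj : Set.InjOn (fun k => k * a % M) (range M : Set ℕ) := by
    intro k hk l hl h
    have hkl : k ≡ l [MOD M] := Nat.ModEq.cancel_right_of_coprime ha h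
    exact hkl.eq_of_lt_of_lt (by simpa using hk) (by simpa using hl)
  exact sum_nbij (fun k => k * a % M) hmaps hinj
    (surjOn_of_injOn_of_card_le _ hmaps hinj le_rfl) fun _ _ => rfl

variable {p : ℕ} [Fact p.Prime]

theorem exists_unit_pow_ne_one {n : ℕ} (hpn : ¬ (p - 1) ∣ n) : ∃ u : (ZMod p)ˣ, u ^ n ≠ 1 := by
  have h := FiniteField.forall_pow_eq_one_iff (ZMod p) n
  rw [ZMod.card] at h
  exact not_forall.mp (h.not.mpr hpn)

theorem sum_range_inv_pow_eq_zero {a : ℕ} (ha : ¬ (p - 1) ∣ a) :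
    ∑ k ∈ range p, ((k : ZMod p)⁻¹) ^ a = 0 := by
  obtain ⟨u, hu⟩ := exists_unit_pow_ne_one ha
  have hc : (((u⁻¹ : (ZMod p)ˣ) : ZMod p).val : ZMod p) = (u : ZMod p)⁻¹ := by
    rw [ZMod.natCast_zmod_val, Units.val_inv_eq_inv_val]
  have h := sum_range_mul_mod (Fact.out : p.Prime).pos
    (ZMod.val_coe_unit_coprime u⁻¹).symm fun k => ((k : ZMod p)⁻¹) ^ a
  simp only [ZMod.natCast_mod, Nat.cast_mul, hc, mul_inv, inv_inv, mul_pow, ← sum_mul] at h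
  refine (mul_right_eq_self₀.mp h).resolve_left fun h1 => hu (Units.ext ?_)
  rwa [Units.val_pow_eq_pow_val]

variable {y : ℕ → ZMod p}

theorem mhs_singleton_eq_zero (hy : IsReciprocal y (p - 1)) {a : ℕ} (ha : ¬ (p - 1) ∣ a) :
    mhs y [a] (p - 1) = 0 := by
  have hrange : range p = range (p - 1 + 1) := by
    rw [Nat.sub_add_cancel (Fact.out : p.Prime).one_le]
  have h := sum_range_inv_pow_eq_zero ha
  rw [hrange, sum_range_succ', Nat.cast_zero, inv_zero,
    zero_pow (by rintro rfl; exact ha (dvd_zero _)), add_zero] at h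
  rw [mhs_singleton, ← h]
  refine sum_congr rfl fun k hk => ?_
  rw [Nat.cast_add_one, eq_inv_of_mul_eq_one_right (hy k (mem_range.mp hk))]

theorem natCast_sub_one_add_one_eq_zero : ((p - 1 : ℕ) : ZMod p) + 1 = 0 := by
  rw [← Nat.cast_add_one, Nat.sub_add_cancel (Fact.out : p.Prime).one_le, ZMod.natCast_self]

theorem two_lt_of_not_sub_one_dvd {n : ℕ} (hpn : ¬ (p - 1) ∣ n) : 2 < p :=
  (Fact.out : p.Prime).two_le.lt_of_ne (by rintro rfl; exact hpn (one_dvd n))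

theorem mhs_pair_eq_zero (hy : IsReciprocal y (p - 1)) {a b : ℕ} (hab : Even (a + b))
    (hb : ¬ (p - 1) ∣ b) (hsum : ¬ (p - 1) ∣ a + b) : mhs y [a, b] (p - 1) = 0 := by
  have h2 : (2 : ZMod p) ≠ 0 := by
    have := ZMod.natCast_eq_zero_iff 2 p
    exact_mod_cast this.not.mpr (Nat.not_dvd_of_pos_of_lt two_pos (two_lt_of_not_sub_one_dvd hb))
  exact (mul_eq_zero.mp (two_mul_mhs_pair_eq_zero hy natCast_sub_one_add_one_eq_zero hab
    (mhs_singleton_eq_zero hy hb) (mhs_singleton_eq_zero hy hsum))).resolve_left h2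

theorem mhs_two_one_one_eq_zero (hp7 : 7 ≤ p) (hy : IsReciprocal y (p - 1)) :
    mhs y [2, 1, 1] (p - 1) = 0 := by
  have hp {a : ℕ} (h0 : 0 < a) (ha : a < 6) : ¬ (p - 1) ∣ a :=
    Nat.not_dvd_of_pos_of_lt h0 (by lia)
  rw [mhs_two_one_one_eq hy natCast_sub_one_add_one_eq_zero,
    mhs_pair_eq_zero hy (by decide) (hp (by lia) (by lia)) (hp (by lia) (by lia)),
    mhs_pair_eq_zero hy (by decide) (hp (by lia) (by lia)) (hp (by lia) (by lia)),
    mhs_pair_eq_zero hy (by decide) (hp (by lia) (by lia)) (hp (by lia) (by lia)),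
    mhs_singleton_eq_zero hy (hp (by lia) (by lia))]
  ring

end Residues

section PadicIntegers

variable {p : ℕ} [Fact p.Prime]

theorem toZMod_eq_zero_iff_dvd (z : ℤ_[p]) : PadicInt.toZMod z = 0 ↔ (p : ℤ_[p]) ∣ z := by
  rw [← RingHom.mem_ker, PadicInt.ker_toZMod, PadicInt.maximalIdeal_eq_span_p,
    Ideal.mem_span_singleton]

theorem natCast_dvd_padicInt_natCast_iff {m : ℕ} : (p : ℤ_[p]) ∣ m ↔ p ∣ m := by
  rw [← toZMod_eq_zero_iff_dvd, map_natCast, ZMod.natCast_eq_zero_iff]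

theorem exists_isReciprocal_padicInt : ∃ x : ℕ → ℤ_[p], IsReciprocal x (p - 1) := by
  refine ⟨fun k => PadicInt.inv (k + 1), fun k hk => PadicInt.mul_inv ?_⟩
  rw [← Nat.cast_add_one, PadicInt.norm_natCast_eq_one_iff]
  exact (Fact.out : p.Prime).coprime_iff_not_dvd.mpr
    (Nat.not_dvd_of_pos_of_lt k.succ_pos (by lia))

variable {x : ℕ → ℤ_[p]}

theorem dvd_mhs_of_map_eq_zero {s : List ℕ} (hs : mhs (PadicInt.toZMod ∘ x) s (p - 1) = 0) :
    (p : ℤ_[p]) ∣ mhs x s (p - 1) := by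
  rwa [← toZMod_eq_zero_iff_dvd, map_mhs]

theorem natCast_eq_sub_one_add_one : (p : ℤ_[p]) = (p - 1 : ℕ) + 1 := by
  rw [← Nat.cast_add_one, Nat.sub_add_cancel (Fact.out : p.Prime).one_le]

theorem sq_dvd_mhs_of_odd (hx : IsReciprocal x (p - 1)) {a : ℕ} (ha : Odd a)
    (hpa : ¬ (p - 1) ∣ a + 1) : (p : ℤ_[p]) ^ 2 ∣ mhs x [a] (p - 1) := by
  have hsucc : (p : ℤ_[p]) ∣ mhs x [a + 1] (p - 1) :=
    dvd_mhs_of_map_eq_zero (mhs_singleton_eq_zero (hx.map _) hpa)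
  have h2 : ¬ (p : ℤ_[p]) ∣ (2 : ℕ) := natCast_dvd_padicInt_natCast_iff.not.mpr
    (Nat.not_dvd_of_pos_of_lt two_pos (two_lt_of_not_sub_one_dvd hpa))
  refine PadicInt.prime_p.pow_dvd_of_dvd_mul_left 2 h2 ?_
  refine (dvd_add_left ?_).mp (sq_dvd_two_mul_mhs_add hx natCast_eq_sub_one_add_one ha)
  rw [sq, mul_assoc]
  exact (mul_dvd_mul_left _ hsucc).mul_left _

theorem pow_five_dvd_two_mul_aperyTwo_sub_mhs (hp7 : 7 ≤ p) (hx : IsReciprocal x (p - 1)) :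
    (p : ℤ_[p]) ^ 5 ∣ 2 * ((aperyTwo (p - 1) : ℤ_[p]) - 1) - 5 * p ^ 2 * mhs x [2] (p - 1) := by
  have hp {a : ℕ} (h0 : 0 < a) (ha : a < 6) : ¬ (p - 1) ∣ a :=
    Nat.not_dvd_of_pos_of_lt h0 (by lia)
  have hy := hx.map PadicInt.toZMod
  obtain ⟨u, hu⟩ := pow_five_dvd_aperyTwo_sub hx ((Fact.out : p.Prime).even_sub_one (by lia))
    natCast_eq_sub_one_add_one
  obtain ⟨v, hv⟩ := pow_three_dvd_inv_sq_relation hx natCast_eq_sub_one_add_one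
  obtain ⟨s1, h1⟩ := sq_dvd_mhs_of_odd hx (a := 1) (by decide) (hp (by lia) (by lia))
  obtain ⟨s3, h3⟩ := sq_dvd_mhs_of_odd hx (a := 3) (by decide) (hp (by lia) (by lia))
  obtain ⟨s31, h31⟩ := dvd_mhs_of_map_eq_zero <|
    mhs_pair_eq_zero (a := 3) (b := 1) hy (by decide) (hp (by lia) (by lia)) (hp (by lia) (by lia))
  obtain ⟨s22, h22⟩ := dvd_mhs_of_map_eq_zero <|
    mhs_pair_eq_zero (a := 2) (b := 2) hy (by decide) (hp (by lia) (by lia)) (hp (by lia) (by lia))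
  obtain ⟨s211, h211⟩ := dvd_mhs_of_map_eq_zero (mhs_two_one_one_eq_zero hp7 hy)
  have hsq := mhs_mul_mhs x 1 1 (p - 1)
  rw [h1, one_add_one_eq_two] at hsq
  rw [h3, h31, h211] at hv
  rw [h3, h31, h22, h211] at hu
  refine ⟨2 * u - 4 * s3 + 4 * s211 - 2 * s22 - 2 * v + p * s1 ^ 2, ?_⟩
  linear_combination 2 * hu - 2 * (p : ℤ_[p]) ^ 2 * hv - (p : ℤ_[p]) ^ 2 * hsq

theorem pow_three_dvd_mhs_two_sub_sum_pow (hp5 : 5 ≤ p) (hx : IsReciprocal x (p - 1)) :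
    (p : ℤ_[p]) ^ 3 ∣ mhs x [2] (p - 1) -
      ∑ k ∈ range p, (3 * (k : ℤ_[p]) ^ (p - 3) - 3 * k ^ (2 * p - 4) + k ^ (3 * p - 5)) := by
  have hrange : range p = range (p - 1 + 1) := by rw [Nat.sub_add_cancel (by lia)]
  have hzero (n : ℕ) (hn : n ≠ 0) : ((0 : ℕ) : ℤ_[p]) ^ n = 0 := by rw [Nat.cast_zero, zero_pow hn]
  rw [hrange, sum_range_succ', hzero _ (by lia), hzero _ (by lia), hzero _ (by lia), mul_zero,
    sub_zero, add_zero, add_zero, mhs_singleton, ← sum_sub_distrib]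
  refine dvd_sum fun k hk => ?_
  have hxk := hx k (mem_range.mp hk)
  rw [Nat.cast_add_one]
  set z : ℤ_[p] := k + 1
  have hfermat : (p : ℤ_[p]) ∣ 1 - z ^ (p - 1) := by
    have hz : PadicInt.toZMod z * PadicInt.toZMod (x k) = 1 := by rw [← map_mul, hxk, map_one]
    rw [← toZMod_eq_zero_iff_dvd, map_sub, map_one, map_pow,
      ZMod.pow_card_sub_one_eq_one (left_ne_zero_of_mul_eq_one hz), sub_self]
  have hinv : x k ^ 2 * z ^ (p - 1) = z ^ (p - 3) := by
    rw [show p - 1 = p - 3 + 2 by lia, pow_add, mul_left_comm, ← mul_pow, mul_comm (x k), hxk,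
      one_pow, mul_one]
  -- `x k ^ 2 = z ^ (-2)`, so the difference of the two sides is a third difference in steps
  -- of `p - 1` in the exponent.
  have hcube : x k ^ 2 - (3 * z ^ (p - 3) - 3 * z ^ (2 * p - 4) + z ^ (3 * p - 5)) =
      x k ^ 2 * (1 - z ^ (p - 1)) ^ 3 := by
    rw [show 2 * p - 4 = p - 3 + (p - 1) by lia,
      show 3 * p - 5 = p - 3 + (p - 1) + (p - 1) by lia, pow_add, pow_add, pow_add, ← hinv]
    ring
  rw [hcube]
  exact (pow_dvd_pow_of_dvd hfermat 3).mul_left _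

theorem pow_five_dvd_two_mul_aperyTwo_sub_sum_pow (hp7 : 7 ≤ p) :
    (p : ℤ) ^ 5 ∣ 2 * ((aperyTwo (p - 1) : ℤ) - 1) - 5 * p ^ 2 *
      ∑ k ∈ range p, (3 * (k : ℤ) ^ (p - 3) - 3 * k ^ (2 * p - 4) + k ^ (3 * p - 5)) := by
  obtain ⟨x, hx⟩ := exists_isReciprocal_padicInt (p := p)
  obtain ⟨u, hu⟩ := pow_five_dvd_two_mul_aperyTwo_sub_mhs hp7 hx
  obtain ⟨v, hv⟩ := pow_three_dvd_mhs_two_sub_sum_pow (by lia) hx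
  rw [← PadicInt.pow_p_dvd_int_iff]
  push_cast
  exact ⟨u + 5 * v, by linear_combination hu + 5 * (p : ℤ_[p]) ^ 2 * hv⟩

end PadicIntegers

section PIntegers

variable (p : ℕ) [Fact p.Prime]

/-- The ring `ℤ₍ₚ₎` of rational numbers whose denominator is prime to `p`. A congruence
`x ≡ y (mod p ^ r)` in `ℤ₍ₚ₎` is expressed below as `(x - y) / p ^ r ∈ pIntegers p`. -/
def pIntegers : Subring ℚ :=
  (Rat.padicValuation p).integer

variable {p}

theorem mem_pIntegers_iff {x : ℚ} : x ∈ pIntegers p ↔ ¬ p ∣ x.den :=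
  Rat.padicValuation_le_one_iff

theorem inv_natCast_mem_pIntegers {n : ℕ} (hn : ¬ p ∣ n) : (n : ℚ)⁻¹ ∈ pIntegers p := by
  have hn0 : n ≠ 0 := by rintro rfl; exact hn (dvd_zero p)
  rwa [mem_pIntegers_iff, Rat.inv_natCast_den, if_neg hn0]

theorem inv_intCast_mem_pIntegers {a : ℤ} (ha : ¬ (p : ℤ) ∣ a) : (a : ℚ)⁻¹ ∈ pIntegers p := by
  have ha0 : a ≠ 0 := by rintro rfl; exact ha (dvd_zero _)
  rwa [mem_pIntegers_iff, Rat.inv_intCast_den, if_neg ha0, ← Int.natCast_dvd]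

theorem intCast_div_pow_mem_pIntegers {r : ℕ} {a : ℤ} (h : (p : ℤ) ^ r ∣ a) :
    (a : ℚ) / p ^ r ∈ pIntegers p := by
  obtain ⟨b, rfl⟩ := h
  have hp0 : (p : ℚ) ≠ 0 := NeZero.ne _
  convert intCast_mem (pIntegers p) b using 1
  push_cast
  field_simp

theorem pow_div_natCast_mem_pIntegers {e m : ℕ} (hm : m ≠ 0) (h : m < p ^ (e + 1)) :
    (p : ℚ) ^ e / m ∈ pIntegers p := by
  have hp : p.Prime := Fact.out
  obtain ⟨f, n, hn, rfl⟩ := Nat.exists_eq_pow_mul_and_not_dvd hm p hp.ne_one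
  have hn0 : 0 < n := Nat.pos_of_ne_zero (by rintro rfl; exact hn (dvd_zero p))
  have hfe : f ≤ e := Nat.lt_succ_iff.mp <| (Nat.pow_lt_pow_iff_right hp.one_lt).mp <|
    (Nat.le_mul_of_pos_right _ hn0).trans_lt h
  have hp0 : (p : ℚ) ≠ 0 := NeZero.ne _
  have : (p : ℚ) ^ e / (p ^ f * n : ℕ) = p ^ (e - f) * (n : ℚ)⁻¹ := by
    rw [pow_sub₀ _ hp0 hfe]
    push_cast
    field_simp
  rw [this]
  exact mul_mem (pow_mem (natCast_mem _ p) _) (inv_natCast_mem_pIntegers hn)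

theorem bernoulli_mem_pIntegers {n : ℕ} (hn : ¬ (p - 1) ∣ n) : bernoulli n ∈ pIntegers p := by
  rcases n.even_or_odd with h | h
  · obtain ⟨k, rfl⟩ := h.two_dvd
    obtain ⟨z, hz⟩ := Bernoulli.vonStaudt_clausen k
    rw [← sub_eq_of_eq_add hz]
    refine sub_mem (intCast_mem _ z) (sum_mem fun q hq => ?_)
    obtain ⟨-, hq, hqn⟩ := mem_filter.mp hq
    rw [one_div]
    refine inv_natCast_mem_pIntegers fun hpq => hn ?_
    rwa [(Nat.prime_dvd_prime_iff_eq Fact.out hq).mp hpq]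
  · have hp2 : ¬ p ∣ 2 := Nat.not_dvd_of_pos_of_lt two_pos (two_lt_of_not_sub_one_dvd hn)
    obtain rfl | hn1 : n = 1 ∨ 1 < n := by have := h.pos; lia
    · rw [bernoulli_one, neg_div, one_div]
      exact neg_mem (inv_natCast_mem_pIntegers hp2)
    · rw [bernoulli_eq_zero_of_odd h hn1]
      exact zero_mem _

theorem natCast_mul_bernoulli_mem_pIntegers (n : ℕ) : p * bernoulli n ∈ pIntegers p := by
  have hinv : ∀ {q : ℕ}, q.Prime → (p : ℚ) * (q : ℚ)⁻¹ ∈ pIntegers p := by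
    intro q hq
    by_cases hpq : p ∣ q
    · rw [← (Nat.prime_dvd_prime_iff_eq Fact.out hq).mp hpq,
        mul_inv_cancel₀ (NeZero.ne _)]
      exact one_mem _
    · exact mul_mem (natCast_mem _ p) (inv_natCast_mem_pIntegers hpq)
  rcases n.even_or_odd with h | h
  · obtain ⟨k, rfl⟩ := h.two_dvd
    obtain ⟨z, hz⟩ := Bernoulli.vonStaudt_clausen k
    rw [← sub_eq_of_eq_add hz, mul_sub, mul_sum]
    refine sub_mem (mul_mem (natCast_mem _ p) (intCast_mem _ z)) (sum_mem fun q hq => ?_)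
    rw [one_div]
    exact hinv (mem_filter.mp hq).2.1
  · obtain rfl | hn1 : n = 1 ∨ 1 < n := by have := h.pos; lia
    · rw [bernoulli_one, neg_div, one_div, mul_neg]
      exact neg_mem (hinv Nat.prime_two)
    · rw [bernoulli_eq_zero_of_odd h hn1, mul_zero]
      exact zero_mem _

end PIntegers

section PowerSums

theorem sum_range_pow_eq_sum_choose_mul_bernoulli (M n : ℕ) :
    ∑ k ∈ range M, (k : ℚ) ^ n =
      ∑ s ∈ range (n + 1), n.choose s * bernoulli (n - s) * M ^ (s + 1) / (s + 1) := by
  rw [sum_range_pow, ← sum_range_reflect]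
  refine sum_congr rfl fun s hs => ?_
  have hs : s ≤ n := Nat.lt_succ_iff.mp (mem_range.mp hs)
  have hchoose : ((n + 1).choose (n - s) : ℚ) * (s + 1) = n.choose s * (n + 1) := by
    have := Nat.choose_mul_succ_eq n (n - s)
    rw [Nat.choose_symm hs, show n + 1 - (n - s) = s + 1 by lia] at this
    exact_mod_cast this.symm
  rw [show n + 1 - 1 - s = n - s by lia, show n + 1 - (n - s) = s + 1 by lia]
  field_simp
  linear_combination (bernoulli (n - s) * (M : ℚ) ^ (s + 1)) * hchoose

variable {p : ℕ} [Fact p.Prime]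

theorem faulhaber_term_div_pow_three_mem_pIntegers (hp5 : 5 ≤ p) {N : ℕ} (hN : 1 ≤ N)
    (m s : ℕ) :
    bernoulli m * ((p ^ N : ℕ) : ℚ) ^ (s + 4) / (s + 4) / ((p : ℚ) ^ N) ^ 3 ∈ pIntegers p := by
  have hs : s + 4 < p ^ (s + 1) :=
    calc s + 4 < 5 ^ (s + 1) := by
          induction s with
          | zero => norm_num
          | succ s ih => rw [pow_succ]; lia
      _ ≤ p ^ (s + 1) := Nat.pow_le_pow_left hp5 _
  obtain ⟨K, rfl⟩ := Nat.exists_eq_add_of_le' hN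
  have h := mul_mem (mul_mem (pow_mem (natCast_mem (pIntegers p) p) (K * (s + 1)))
    (natCast_mul_bernoulli_mem_pIntegers m)) (pow_div_natCast_mem_pIntegers (by lia) hs)
  convert h using 1
  push_cast
  field_simp
  ring

theorem sum_range_pow_sub_mem_pIntegers (hp5 : 5 ≤ p) {N : ℕ} (hN : 1 ≤ N) (n : ℕ) :
    (∑ k ∈ range (p ^ N), (k : ℚ) ^ (n + 2) - (p ^ N * bernoulli (n + 2) +
      (n + 2) / 2 * (p ^ N) ^ 2 * bernoulli (n + 1) +
      (n + 2) * (n + 1) / 6 * (p ^ N) ^ 3 * bernoulli n)) / (p ^ N) ^ 3 ∈ pIntegers p := by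
  have hchoose : ((n + 2).choose 2 : ℚ) = (n + 2) * (n + 1) / 2 := by
    rw [Nat.cast_choose_two]
    push_cast
    ring
  have h : ∑ s ∈ range n, ((n + 2).choose (s + 3) : ℚ) *
      (bernoulli (n + 2 - (s + 3)) * ((p ^ N : ℕ) : ℚ) ^ (s + 4) / (s + 4) / ((p : ℚ) ^ N) ^ 3) ∈
        pIntegers p := sum_mem fun s _ => mul_mem (natCast_mem _ _)
    (faulhaber_term_div_pow_three_mem_pIntegers hp5 hN _ s)
  convert h using 1
  rw [sum_range_pow_eq_sum_choose_mul_bernoulli, sum_range_succ', sum_range_succ',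
    sum_range_succ', add_assoc, add_assoc, show n + 2 - (0 + 1 + 1) = n by lia,
    show n + 2 - (0 + 1) = n + 1 by lia, show 0 + 1 + 1 = 2 by rfl, hchoose, add_sub_assoc,
    add_div, sum_div]
  simp only [zero_add, Nat.choose_zero_right, Nat.choose_one_right, Nat.sub_zero]
  push_cast
  rw [← sub_eq_zero, add_sub_right_comm, ← sum_sub_distrib, sum_eq_zero fun s _ => by ring]
  ring

theorem inv_three_mem_pIntegers (hp5 : 5 ≤ p) : (3 : ℚ)⁻¹ ∈ pIntegers p :=
  inv_natCast_mem_pIntegers (n := 3) fun h => by have := Nat.le_of_dvd three_pos h; lia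

theorem inv_two_mem_pIntegers (hp5 : 5 ≤ p) : (2 : ℚ)⁻¹ ∈ pIntegers p :=
  inv_natCast_mem_pIntegers (n := 2) fun h => by have := Nat.le_of_dvd two_pos h; lia

theorem sum_range_even_pow_sub_div_sq_mem_pIntegers (hp5 : 5 ≤ p) {N n : ℕ} (hN : 1 ≤ N)
    (hn : Even n) (hn2 : 2 ≤ n) :
    (∑ k ∈ range (p ^ N), (k : ℚ) ^ n - p ^ N * bernoulli n) / (p ^ N) ^ 2 ∈ pIntegers p := by
  obtain ⟨m, rfl⟩ := Nat.exists_eq_add_of_le' hn2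
  obtain ⟨K, rfl⟩ := Nat.exists_eq_add_of_le' hN
  have hB : bernoulli (m + 1) * 2⁻¹ ∈ pIntegers p := by
    refine mul_mem (bernoulli_mem_pIntegers fun h => ?_) (inv_two_mem_pIntegers hp5)
    have heven : Even (m + 1) := ((Fact.out : p.Prime).even_sub_one (by lia)).trans_dvd h
    grind
  have h := add_mem (add_mem
    (mul_mem (natCast_mem _ (p ^ (K + 1))) (sum_range_pow_sub_mem_pIntegers hp5 hN m))
    (mul_mem (natCast_mem _ (m + 2)) hB))
    (mul_mem (mul_mem (natCast_mem _ ((m + 2).choose 2 * p ^ K)) (inv_three_mem_pIntegers hp5))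
      (natCast_mul_bernoulli_mem_pIntegers m))
  convert h using 1
  push_cast [Nat.cast_choose_two]
  field_simp
  ring

theorem sum_range_pow_sub_div_cube_mem_pIntegers (hp5 : 5 ≤ p) {N m : ℕ} (hN : 1 ≤ N)
    (hm : Even m) (hm0 : m ≠ 0) (hpm : ¬ (p - 1) ∣ m) :
    (∑ k ∈ range (p ^ N), (k : ℚ) ^ (m + 2) - p ^ N * bernoulli (m + 2)) / (p ^ N) ^ 3 ∈
      pIntegers p := by
  have h := add_mem (sum_range_pow_sub_mem_pIntegers hp5 hN m)
    (mul_mem (mul_mem (natCast_mem _ ((m + 2).choose 2)) (inv_three_mem_pIntegers hp5))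
      (bernoulli_mem_pIntegers hpm))
  convert h using 1
  rw [bernoulli_eq_zero_of_odd hm.add_one (by lia), Nat.cast_choose_two]
  push_cast
  field_simp
  ring

end PowerSums

section Kummer

/-- The sum of `⌊ka / M⌋ (ka) ^ m` over `k < M` in Voronoi's congruence. -/
def voronoiSum (M a m : ℕ) : ℤ :=
  ∑ k ∈ range M, ((k * a / M : ℕ) : ℤ) * ((k : ℤ) * a) ^ m

theorem sq_dvd_pow_sub_one_mul_sum_range_pow_sub {M a : ℕ} (hM : 0 < M) (ha : M.Coprime a)
    (n : ℕ) :
    (M : ℤ) ^ 2 ∣ ((a : ℤ) ^ n - 1) * ∑ k ∈ range M, (k : ℤ) ^ n -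
      n * M * voronoiSum M a (n - 1) := by
  have hperm : ((a : ℤ) ^ n - 1) * ∑ k ∈ range M, (k : ℤ) ^ n =
      ∑ k ∈ range M, (((k : ℤ) * a) ^ n - ((k * a % M : ℕ) : ℤ) ^ n) := by
    rw [sum_sub_distrib, sum_range_mul_mod hM ha fun k => (k : ℤ) ^ n]
    simp only [mul_pow, ← sum_mul]
    ring
  rw [hperm, voronoiSum, mul_sum, ← sum_sub_distrib]
  refine dvd_sum fun k _ => ?_
  have hmod : ((k * a % M : ℕ) : ℤ) = (k : ℤ) * a + -(M * (k * a / M : ℕ)) := by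
    push_cast [Int.emod_def]
    ring
  obtain ⟨c, hc⟩ := Polynomial.powAddExpansion ((k : ℤ) * a) (-(M * (k * a / M : ℕ))) n
  rw [hmod, hc]
  exact ⟨-c * ((k * a / M : ℕ) : ℤ) ^ 2, by ring⟩

/-- The divided Bernoulli number `Bₙ / n`, for which Kummer's congruences hold. -/
def dividedBernoulli (n : ℕ) : ℚ :=
  bernoulli n / n

theorem natCast_mul_dividedBernoulli {n : ℕ} (hn : n ≠ 0) :
    n * dividedBernoulli n = bernoulli n :=
  mul_div_cancel₀ _ (Nat.cast_ne_zero.mpr hn)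

theorem bernoulli_sub_eq_mul_dividedBernoulli {a b : ℕ} (h : b < a) :
    bernoulli (a - b) = (a - b) * dividedBernoulli (a - b) := by
  rw [← natCast_mul_dividedBernoulli (Nat.sub_ne_zero_of_lt h), Nat.cast_sub h.le]

variable {p : ℕ} [Fact p.Prime]

theorem five_le_of_not_sub_one_dvd_even {n : ℕ} (hn : Even n) (hpn : ¬ (p - 1) ∣ n) : 5 ≤ p := by
  have hp : p.Prime := Fact.out
  by_contra! h
  interval_cases p
  · exact absurd hp (by decide)
  · exact absurd hp (by decide)
  · exact hpn (one_dvd n)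
  · exact hpn hn.two_dvd
  · exact absurd hp (by decide)

theorem two_le_of_not_dvd_even {d n : ℕ} (hn : Even n) (hdn : ¬ d ∣ n) : 2 ≤ n := by
  have hn0 : n ≠ 0 := by rintro rfl; exact hdn (dvd_zero d)
  obtain ⟨m, rfl⟩ := hn
  lia

theorem voronoi_congruence (hp5 : 5 ≤ p) {N a n : ℕ} (hN : 1 ≤ N) (ha : p.Coprime a)
    (hn : Even n) (hn2 : 2 ≤ n) :
    (((a : ℚ) ^ n - 1) * bernoulli n - n * voronoiSum (p ^ N) a (n - 1)) / p ^ N ∈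
      pIntegers p := by
  obtain ⟨c, hc⟩ := sq_dvd_pow_sub_one_mul_sum_range_pow_sub
    (pow_pos (Fact.out : p.Prime).pos N) (ha.pow_left N) n
  have h := sub_mem (intCast_mem _ c) (mul_mem (sub_mem (pow_mem (natCast_mem _ a) n) (one_mem _))
    (sum_range_even_pow_sub_div_sq_mem_pIntegers hp5 hN hn hn2))
  convert h using 1
  have hc : ((a : ℚ) ^ n - 1) * ∑ k ∈ range (p ^ N), (k : ℚ) ^ n -
      n * p ^ N * voronoiSum (p ^ N) a (n - 1) = (p ^ N) ^ 2 * c := by exact_mod_cast hc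
  field_simp
  linear_combination hc

/-- Dividing by `n` costs at most `n` powers of `p`. -/
theorem voronoi_congruence_div (hp5 : 5 ≤ p) {r n a N : ℕ} (hN : r + n ≤ N)
    (ha : p.Coprime a) (hn : Even n) (hn2 : 2 ≤ n) :
    (((a : ℚ) ^ n - 1) * dividedBernoulli n - voronoiSum (p ^ N) a (n - 1)) / p ^ r ∈
      pIntegers p := by
  obtain ⟨d, rfl⟩ := Nat.exists_eq_add_of_le hN
  have hpow : (p : ℚ) ^ n / n ∈ pIntegers p := pow_div_natCast_mem_pIntegers (by lia)
    ((Nat.lt_succ_self n).trans (Nat.lt_pow_self (Fact.out : p.Prime).one_lt))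
  have h := mul_mem (mul_mem (pow_mem (natCast_mem _ p) d) hpow)
    (voronoi_congruence hp5 (N := r + n + d) (by lia) ha hn hn2)
  have hn0 : (n : ℚ) ≠ 0 := by exact_mod_cast (by lia : n ≠ 0)
  rw [← natCast_mul_dividedBernoulli (n := n) (by lia)] at h
  convert h using 1
  field_simp
  ring

theorem exists_coprime_and_not_dvd_pow_sub_one {n : ℕ} (hpn : ¬ (p - 1) ∣ n) (r : ℕ) :
    ∃ a : ℕ, p.Coprime a ∧ ¬ (p : ℤ) ∣ (a : ℤ) ^ n - 1 ∧ (p : ℤ) ^ r ∣ (a : ℤ) ^ (p - 1) - 1 := by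
  obtain ⟨u, hu⟩ := exists_unit_pow_ne_one hpn
  set c := (u : ZMod p).val
  have hc : (c : ZMod p) = u := ZMod.natCast_zmod_val _
  -- `c` is replaced by `c ^ p ^ r`, which is closer to a `(p - 1)`-st root of unity.
  have ha : ((c ^ p ^ r : ℕ) : ZMod p) = u := by rw [Nat.cast_pow, ZMod.pow_card_pow, hc]
  refine ⟨c ^ p ^ r, ?_, fun h => hu (Units.ext ?_), ?_⟩
  · exact ((ZMod.isUnit_iff_coprime _ _).mp (ha ▸ u.isUnit)).symm
  · have h := (ZMod.intCast_zmod_eq_zero_iff_dvd _ _).mpr h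
    push_cast [← ha] at h ⊢
    exact sub_eq_zero.mp h
  · have hfermat : (p : ℤ) ∣ (c : ℤ) ^ (p - 1) - 1 ^ (p - 1) := by
      rw [← ZMod.intCast_zmod_eq_zero_iff_dvd]
      push_cast
      rw [hc, ZMod.pow_card_sub_one_eq_one u.ne_zero, one_pow, sub_self]
    have h := dvd_sub_pow_of_dvd_sub hfermat r
    rw [one_pow, one_pow, pow_right_comm] at h
    push_cast
    exact (pow_dvd_pow _ r.le_succ).trans h

theorem mul_div_pow_mem_pIntegers_iff {u : ℤ} (hu : ¬ (p : ℤ) ∣ u) {r : ℕ} {x : ℚ} :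
    u * x / p ^ r ∈ pIntegers p ↔ x / p ^ r ∈ pIntegers p := by
  refine ⟨fun h => ?_, fun h => mul_div_assoc (u : ℚ) x _ ▸ mul_mem (intCast_mem _ u) h⟩
  have hu0 : (u : ℚ) ≠ 0 := Int.cast_ne_zero.mpr fun h0 => hu (h0 ▸ dvd_zero _)
  convert mul_mem (inv_intCast_mem_pIntegers hu) h using 1
  field_simp

theorem dividedBernoulli_mem_pIntegers {n : ℕ} (hn : Even n) (hpn : ¬ (p - 1) ∣ n) :
    dividedBernoulli n ∈ pIntegers p := by
  obtain ⟨a, ha, han, -⟩ := exists_coprime_and_not_dvd_pow_sub_one hpn 0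
  have hn2 := two_le_of_not_dvd_even hn hpn
  have h := add_mem (voronoi_congruence_div (five_le_of_not_sub_one_dvd_even hn hpn)
    (r := 0) (zero_add n).le ha hn hn2) (intCast_mem _ (voronoiSum (p ^ n) a (n - 1)))
  have := mul_div_pow_mem_pIntegers_iff han (r := 0) (x := dividedBernoulli n)
  simp only [pow_zero, div_one] at this h
  rw [← this]
  push_cast
  rwa [sub_add_cancel] at h

theorem pow_dvd_sum_neg_one_pow_mul_choose_mul_pow {r m : ℕ} (hm : r ≤ m) (x : ℤ) :
    (p : ℤ) ^ r ∣ ∑ i ∈ range (r + 1), (-1) ^ i * r.choose i * x ^ (m + i * (p - 1)) := by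
  have hsum : ∑ i ∈ range (r + 1), (-1) ^ i * r.choose i * x ^ (m + i * (p - 1)) =
      x ^ m * (1 - x ^ (p - 1)) ^ r := by
    rw [sub_eq_neg_add, add_pow, mul_sum]
    refine sum_congr rfl fun i _ => ?_
    rw [neg_pow, pow_add, mul_comm i, pow_mul]
    ring
  rw [hsum]
  by_cases hx : (p : ℤ) ∣ x
  · exact ((pow_dvd_pow_of_dvd hx r).trans (pow_dvd_pow x hm)).mul_right _
  · refine (pow_dvd_pow_of_dvd ?_ r).mul_left _
    rw [← ZMod.intCast_zmod_eq_zero_iff_dvd] at hx ⊢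
    push_cast
    rw [ZMod.pow_card_sub_one_eq_one hx, sub_self]

theorem pow_dvd_sum_neg_one_pow_mul_choose_mul_voronoiSum {r m : ℕ} (hm : r ≤ m) (M a : ℕ) :
    (p : ℤ) ^ r ∣ ∑ i ∈ range (r + 1), (-1) ^ i * r.choose i *
      voronoiSum M a (m + i * (p - 1)) := by
  simp only [voronoiSum, mul_sum]
  rw [sum_comm]
  refine dvd_sum fun k _ => ?_
  have h := (pow_dvd_sum_neg_one_pow_mul_choose_mul_pow (p := p) hm ((k : ℤ) * a)).mul_left
    ((k * a / M : ℕ) : ℤ)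
  rw [mul_sum] at h
  convert h using 2
  ring

theorem voronoi_congruence_add_mul_sub_one {n r i N a : ℕ} (hn : Even n) (hpn : ¬ (p - 1) ∣ n)
    (hN : r + (n + i * (p - 1)) ≤ N) (ha : p.Coprime a)
    (har : (p : ℤ) ^ r ∣ (a : ℤ) ^ (p - 1) - 1) :
    (((a : ℚ) ^ n - 1) * dividedBernoulli (n + i * (p - 1)) -
      voronoiSum (p ^ N) a (n - 1 + i * (p - 1))) / p ^ r ∈ pIntegers p := by
  have hp5 := five_le_of_not_sub_one_dvd_even hn hpn
  have hn2 := two_le_of_not_dvd_even hn hpn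
  have heven : Even (n + i * (p - 1)) :=
    hn.add (((Fact.out : p.Prime).even_sub_one (by lia)).mul_left i)
  have hndvd : ¬ (p - 1) ∣ n + i * (p - 1) := by
    rwa [Nat.dvd_add_left (Dvd.intro_left i rfl)]
  have hpow : (p : ℤ) ^ r ∣ (a : ℤ) ^ n - a ^ (n + i * (p - 1)) := by
    rw [show (a : ℤ) ^ n - a ^ (n + i * (p - 1)) = -a ^ n * (a ^ (i * (p - 1)) - 1) by ring]
    exact (har.trans (dvd_pow_sub_one_of_dvd (Dvd.intro_left i rfl))).mul_left _
  have h := add_mem (voronoi_congruence_div hp5 hN ha heven (by lia))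
    (mul_mem (intCast_div_pow_mem_pIntegers hpow) (dividedBernoulli_mem_pIntegers heven hndvd))
  rw [show n + i * (p - 1) - 1 = n - 1 + i * (p - 1) by lia] at h
  convert h using 1
  push_cast
  ring

theorem kummer_congruence {n r : ℕ} (hr : r < n) (hn : Even n) (hpn : ¬ (p - 1) ∣ n) :
    (∑ i ∈ range (r + 1), (-1) ^ i * r.choose i * dividedBernoulli (n + i * (p - 1))) / p ^ r ∈
      pIntegers p := by
  obtain ⟨a, ha, han, har⟩ := exists_coprime_and_not_dvd_pow_sub_one hpn r
  rw [← mul_div_pow_mem_pIntegers_iff han]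
  -- One modulus `p ^ N` serves all `i`, so that the Voronoi sums can be combined termwise.
  obtain ⟨N, hN⟩ : ∃ N, ∀ i ∈ range (r + 1), r + (n + i * (p - 1)) ≤ N :=
    ⟨r + (n + r * (p - 1)), fun i hi => by have := mem_range_succ_iff.mp hi; gcongr⟩
  have hvoronoi : ∀ i ∈ range (r + 1), (((a : ℚ) ^ n - 1) * dividedBernoulli (n + i * (p - 1)) -
      voronoiSum (p ^ N) a (n - 1 + i * (p - 1))) / p ^ r ∈ pIntegers p := fun i hi =>
    voronoi_congruence_add_mul_sub_one hn hpn (hN i hi) ha har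
  have hV := pow_dvd_sum_neg_one_pow_mul_choose_mul_voronoiSum (p := p)
    (Nat.le_sub_one_of_lt hr) (p ^ N) a
  have h := add_mem (sum_mem fun i hi => mul_mem (mul_mem
    (pow_mem (neg_mem (one_mem _)) i) (natCast_mem _ (r.choose i))) (hvoronoi i hi))
    (intCast_div_pow_mem_pIntegers hV)
  convert h using 1
  push_cast
  rw [sum_div, ← sum_add_distrib, mul_sum, sum_div]
  exact sum_congr rfl fun i _ => by ring

end Kummer

section Apery

variable {p : ℕ} [Fact p.Prime]

theorem odd_of_seven_le (hp7 : 7 ≤ p) : Odd p :=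
  (Fact.out : p.Prime).odd_of_ne_two (by lia)

theorem dividedBernoulli_sub_div_mem (hp7 : 7 ≤ p) :
    (dividedBernoulli (p - 3) - dividedBernoulli (2 * p - 4)) / p ∈ pIntegers p := by
  have h := kummer_congruence (p := p) (n := p - 3) (r := 1) (by lia)
    ((odd_of_seven_le hp7).tsub_odd (by decide)) (Nat.not_dvd_of_pos_of_lt (by lia) (by lia))
  convert h using 1
  simp [sum_range_succ, show p - 3 + (p - 1) = 2 * p - 4 by lia, sub_eq_add_neg]

theorem dividedBernoulli_sub_two_mul_add_div_sq_mem (hp7 : 7 ≤ p) :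
    (dividedBernoulli (p - 3) - 2 * dividedBernoulli (2 * p - 4) + dividedBernoulli (3 * p - 5)) /
      p ^ 2 ∈ pIntegers p := by
  have h := kummer_congruence (p := p) (n := p - 3) (r := 2) (by lia)
    ((odd_of_seven_le hp7).tsub_odd (by decide)) (Nat.not_dvd_of_pos_of_lt (by lia) (by lia))
  convert h using 1
  simp [sum_range_succ, show p - 3 + (p - 1) = 2 * p - 4 by lia,
    show p - 3 + 2 * (p - 1) = 3 * p - 5 by lia, sub_eq_add_neg]

theorem sum_range_pow_add_mul_sub_mem (hp7 : 7 ≤ p) (i : ℕ) :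
    (∑ k ∈ range p, (k : ℚ) ^ (p - 3 + i * (p - 1)) - p * bernoulli (p - 3 + i * (p - 1))) / p ^ 3 ∈
      pIntegers p := by
  have hodd := odd_of_seven_le hp7
  have h := sum_range_pow_sub_div_cube_mem_pIntegers (p := p) (by lia) (N := 1)
    (m := p - 5 + i * (p - 1)) le_rfl
    ((hodd.tsub_odd (by decide)).add ((hodd.tsub_odd odd_one).mul_left i)) (by lia)
    (by rw [Nat.dvd_add_left (Dvd.intro_left i rfl)]
        exact Nat.not_dvd_of_pos_of_lt (by lia) (by lia))
  simpa only [show p - 5 + i * (p - 1) + 2 = p - 3 + i * (p - 1) by lia, pow_one] using h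

theorem aperyTwo_sub_mem_pIntegers (hp7 : 7 ≤ p) :
    ((aperyTwo (p - 1) : ℚ) -
      (1 + 5 * p ^ 3 * (dividedBernoulli (2 * p - 4) - 2 * dividedBernoulli (p - 3)))) / p ^ 5 ∈
        pIntegers p := by
  have hT := sum_range_pow_add_mul_sub_mem hp7
  have h0 := hT 0
  have h1 := hT 1
  have h2 := hT 2
  rw [zero_mul, add_zero, bernoulli_sub_eq_mul_dividedBernoulli (by lia)] at h0
  rw [show p - 3 + 1 * (p - 1) = 2 * p - 4 by lia,
    bernoulli_sub_eq_mul_dividedBernoulli (by lia)] at h1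
  rw [show p - 3 + 2 * (p - 1) = 3 * p - 5 by lia,
    bernoulli_sub_eq_mul_dividedBernoulli (by lia)] at h2
  have key := mul_mem (inv_two_mem_pIntegers (p := p) (by lia)) <|
    add_mem (intCast_div_pow_mem_pIntegers (pow_five_dvd_two_mul_aperyTwo_sub_sum_pow hp7)) <|
    mul_mem (natCast_mem _ 5) <| add_mem (add_mem (mul_mem (natCast_mem _ 3) (sub_mem h0 h1)) h2) <|
      mul_mem (intCast_mem _ (3 * p - 5)) (dividedBernoulli_sub_two_mul_add_div_sq_mem hp7)
  convert key using 1
  push_cast [sum_add_distrib, sum_sub_distrib, ← mul_sum]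
  field_simp
  ring

theorem ratModEq_of_sub_div_mem {r : ℕ} {x y : ℚ} (h : (x - y) / p ^ r ∈ pIntegers p) :
    RatModEq (p ^ r) x y := by
  have hp0 : (p : ℚ) ≠ 0 := NeZero.ne _
  refine ⟨(x - y) / p ^ r, (Nat.Coprime.pow_left r ?_).symm, ?_⟩
  · exact (Fact.out : p.Prime).coprime_iff_not_dvd.mpr (mem_pIntegers_iff.mp h)
  · push_cast
    field_simp

end Apery

theorem theorem1p2 (p : ℕ) (hp : p.Prime) (hp7 : 7 ≤ p) :
    RatModEq (p ^ 5) (aperyTwo (p - 1) : ℚ)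
      (1 + (p : ℚ) ^ 3 * (10 / 3 * bernoulli (p - 3) - 5 / 4 * bernoulli (2 * p - 4))
        + 5 / 18 * (p : ℚ) ^ 4 * bernoulli (p - 3)) := by
  have := Fact.mk hp
  apply ratModEq_of_sub_div_mem
  have h2 : (2 : ℚ)⁻¹ ∈ pIntegers p := inv_two_mem_pIntegers (by lia)
  have h3 : (3 : ℚ)⁻¹ ∈ pIntegers p := inv_three_mem_pIntegers (by lia)
  have hβ : dividedBernoulli (p - 3) ∈ pIntegers p := dividedBernoulli_mem_pIntegers
    ((odd_of_seven_le hp7).tsub_odd (by decide)) (Nat.not_dvd_of_pos_of_lt (by lia) (by lia))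
  have hcorr := mul_mem (mul_mem (natCast_mem _ 5) h2) <|
    add_mem (dividedBernoulli_sub_div_mem hp7) (mul_mem (mul_mem h3 h3) hβ)
  convert sub_mem (aperyTwo_sub_mem_pIntegers hp7) hcorr using 1
  rw [bernoulli_sub_eq_mul_dividedBernoulli (by lia),
    bernoulli_sub_eq_mul_dividedBernoulli (by lia)]
  push_cast
  field_simp
  ring
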